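/- For $A\in 2^\omega$ let $[A]=\{B\in 2^\omega : B\equiv_{\mathrm T}A\}$ be its Turing degree, and let $\mathscr D_2=2^\omega/{\equiv_{\mathrm T}}$ be the set of Turing degrees, partially ordered by Turing reducibility. An automorphism of $\mathscr D_2$ is a bijection $\pi:\mathscr D_2\to\mathscr D_2$ such that for all $\mathbf x,\mathbf y\in\mathscr D_2$, $\mathbf x\le\mathbf y$ if and only if $\pi(\mathbf x)\le\pi(\mathbf y)$. For $f:\omega\to\omega$ let $f^*:2^\omega\to 2^\omega$, $f^*(A)(n)=A(f(n))$, be its pullback; $\pi$ is induced by $f$ if $\pi([A])=[f^*(A)]$ for every $A\in 2^\omega$. **Theorem.** If $\pi$ is an automorphism of $\mathscr D_2$ which is induced by a permutation $f$ of $\omega$, then $\pi(\mathbf p)=\mathbf p$ for each $\mathbf p\in\mathscr D_2$; that is, $f^*(p)\equiv_{\mathrm T}p$ for every $p\in 2^\omega$. -/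

import Mathlib

/-- `InfSeq S` is the set `S^ω` of infinite sequences of elements of `S ⊆ ω`.  It is a type synonym
of `ℕ → S`, so that it can be ordered by Turing reducibility instead of pointwise. -/
def InfSeq (S : Set ℕ) : Type := ℕ → S

namespace InfSeq

variable {S : Set ℕ}

/-- A sequence in `S^ω`, regarded as a (total) function `ω → ω`. -/
def toPFun (A : InfSeq S) : ℕ →. ℕ := fun n => Part.some (A n : ℕ)

/-- `S^ω` is preordered by Turing reducibility: `A ≤ B` means that `A` is computable with
oracle `B`. -/
instance : Preorder (InfSeq S) where
  le A B := TuringReducible A.toPFun B.toPFun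
  le_refl _ := TuringReducible.refl _
  le_trans _ _ _ h₁ h₂ := TuringReducible.trans h₁ h₂

/-- The pullback `f^* : S^ω → S^ω` of `f : ω → ω`, given by `f^*(A)(n) = A(f(n))`. -/
def pullback (f : ℕ → ℕ) (A : InfSeq S) : InfSeq S := fun n => A (f n)

end InfSeq

/-- The degree structure `D_S = S^ω / ≡_T`.  As an antisymmetrization it carries
the partial order induced by Turing reducibility. -/
abbrev DegreesOf (S : Set ℕ) : Type := Antisymmetrization (InfSeq S) (· ≤ ·)

/-- The Turing degree `[A]_S` of `A ∈ S^ω`. -/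
def InfSeq.degree {S : Set ℕ} (A : InfSeq S) : DegreesOf S := toAntisymmetrization (· ≤ ·) A

/-- The map `π : D_S → D_S` is induced by `f : ω → ω`: one has `π([A]_S) = [f^*(A)]_S` for all
`A ∈ S^ω`.  This includes that `[f^*(A)]_S` depends on `[A]_S` only. -/
def IsInducedBy {S : Set ℕ} (π : DegreesOf S → DegreesOf S) (f : ℕ → ℕ) : Prop :=
  ∀ A : InfSeq S, π A.degree = (A.pullback f).degree

/-! The permutation `f` turns out to be computable; then `f` and its inverse pull each sequence back
to one below it, so degrees do not move. Let `h` be the conjugate f⁻¹ ∘ S ∘ f of the successor S.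
For any `B`, the sequence A = B ∘ f⁻¹ computes A ∘ S. As `π` is monotone and induced by `f`, pulling
back along `f` shows that `B` computes B ∘ h (`IsInducedBy.computable`).

The reduction may depend on `B`, but there are only countably many. By the Baire category theorem a
single partial recursive `F` works for a set of `B` that is dense above some string `σ`
(`exists_denselyComputes`). Density forces any value that `F` computes at `n` from a string above
`σ` to be the bit at place `h n`. Hence `h n` can be found by searching for two strings that differ
in one place and yield different values (`DenselyComputes.computable`). Finally f⁻¹(n + 1) =
h(f⁻¹(n)), so f⁻¹ is computable by recursion, and so is `f`. -/

/-! ### Finite prefixes and the use principle -/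

/-- The first `k` bits of an infinite binary sequence. -/
def bitPrefix (B : ℕ → Bool) (k : ℕ) : List Bool := (List.range k).map B

theorem bitPrefix_length (B : ℕ → Bool) (k : ℕ) : (bitPrefix B k).length = k := by
  simp [bitPrefix]

theorem bitPrefix_getElem? (B : ℕ → Bool) (k i : ℕ) :
    (bitPrefix B k)[i]? = if i < k then some (B i) else none := by
  by_cases h : i < k <;> simp [bitPrefix, h]

theorem bitPrefix_isPrefix (B : ℕ → Bool) {k l : ℕ} (h : k ≤ l) :
    bitPrefix B k <+: bitPrefix B l := by
  obtain ⟨d, rfl⟩ := Nat.exists_eq_add_of_le h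
  simp [bitPrefix, List.range_add]

/-- A family of partial functions indexed by finite binary strings is extension-monotone if longer
strings yield more convergent values and keep those already computed. -/
def ExtensionMonotone (F : List Bool → ℕ →. ℕ) : Prop :=
  ∀ ⦃a b : List Bool⦄, a <+: b → ∀ ⦃n v : ℕ⦄, v ∈ F a n → v ∈ F b n

/-- `F`, evaluated along the finite prefixes of `B`, computes exactly the partial function `g`. -/
def Approximates (F : List Bool → ℕ →. ℕ) (B : ℕ → Bool) (g : ℕ →. ℕ) : Prop :=
  ∀ n v, v ∈ g n ↔ ∃ k, v ∈ F (bitPrefix B k) n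

/-- Membership in `F` along the prefixes of `B` persists. -/
theorem ExtensionMonotone.mem_of_le {F : List Bool → ℕ →. ℕ} (hF : ExtensionMonotone F)
    (B : ℕ → Bool) {k l n v : ℕ} (h : k ≤ l) (hv : v ∈ F (bitPrefix B k) n) :
    v ∈ F (bitPrefix B l) n :=
  hF (bitPrefix_isPrefix B h) hv

/-- The partial recursive operation of primitive recursion, relative to two partial functions. -/
def partPrec (f h : ℕ →. ℕ) (a n : ℕ) : Part ℕ :=
  n.rec (f a) fun y IH => IH.bind fun i => h (Nat.pair a (Nat.pair y i))

theorem partPrec_succ (f h : ℕ →. ℕ) (a n : ℕ) :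
    partPrec f h a (n + 1) =
      (partPrec f h a n).bind fun i => h (Nat.pair a (Nat.pair n i)) := rfl

theorem partPrec_mono {f h f' h' : ℕ →. ℕ} (hf : ∀ n v, v ∈ f n → v ∈ f' n)
    (hh : ∀ n v, v ∈ h n → v ∈ h' n) (a n : ℕ) :
    ∀ v, v ∈ partPrec f h a n → v ∈ partPrec f' h' a n := by
  induction n with
  | zero => exact hf a
  | succ n ih =>
    intro v hv
    rw [partPrec_succ, Part.mem_bind_iff] at hv ⊢
    obtain ⟨i, hi, hv⟩ := hv
    exact ⟨i, ih i hi, hh _ _ hv⟩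

theorem ExtensionMonotone.partPrec_mem_of_le {F G : List Bool → ℕ →. ℕ}
    (hF : ExtensionMonotone F) (hG : ExtensionMonotone G) (B : ℕ → Bool) {k l a n v : ℕ}
    (h : k ≤ l) (hv : v ∈ partPrec (F (bitPrefix B k)) (G (bitPrefix B k)) a n) :
    v ∈ partPrec (F (bitPrefix B l)) (G (bitPrefix B l)) a n :=
  partPrec_mono (fun _ _ => hF.mem_of_le B h) (fun _ _ => hG.mem_of_le B h) a n v hv

/-- The use principle: a function recursive in a binary sequence is approximated by a partial
recursive monotone operation on the finite prefixes of that sequence. -/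
theorem exists_approximates_of_recursiveIn {B : ℕ → Bool} {g : ℕ →. ℕ}
    (hg : Nat.RecursiveIn {fun n => Part.some (B n).toNat} g) :
    ∃ F : List Bool → ℕ →. ℕ, Partrec₂ F ∧ ExtensionMonotone F ∧ Approximates F B g := by
  induction hg with
  | zero =>
    exact ⟨fun _ _ => Part.some 0, (Computable.const 0).partrec, fun _ _ _ _ _ h => h,
      fun n v => by
        change v ∈ Part.some 0 ↔ _
        simp⟩
  | succ =>
    exact ⟨fun _ n => Part.some n.succ, (Computable.succ.comp Computable.snd).partrec,
      fun _ _ _ _ _ h => h, fun n v => by simp⟩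
  | left =>
    exact ⟨fun _ n => Part.some n.unpair.1,
      (Computable.fst.comp (Computable.unpair.comp Computable.snd)).partrec,
      fun _ _ _ _ _ h => h, fun n v => by simp⟩
  | right =>
    exact ⟨fun _ n => Part.some n.unpair.2,
      (Computable.snd.comp (Computable.unpair.comp Computable.snd)).partrec,
      fun _ _ _ _ _ h => h, fun n v => by simp⟩
  | oracle g hg =>
    obtain rfl : g = _ := hg
    -- An oracle query beyond the end of the string diverges.
    refine ⟨fun τ n => ((τ[n]?.map Bool.toNat : Option ℕ) : Part ℕ), ?_, ?_, ?_⟩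
    · refine Computable.ofOption (f := fun p : List Bool × ℕ => p.1[p.2]?.map Bool.toNat) ?_
      refine Computable.option_map
        (Computable.list_getElem?.comp Computable.fst Computable.snd) ?_
      exact ((Primrec.dom_finite Bool.toNat).comp Primrec.snd).to_comp
    · rintro a b ⟨c, rfl⟩ n v hv
      simp only [Part.mem_ofOption, Option.mem_def, Option.map_eq_some_iff] at hv ⊢
      obtain ⟨x, hx, rfl⟩ := hv
      exact ⟨x, by rw [List.getElem?_append_left (List.getElem?_eq_some_iff.1 hx).1, hx], rfl⟩
    · intro n v
      simp only [Part.mem_ofOption, Option.mem_def, Option.map_eq_some_iff, Part.mem_some_iff,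
        bitPrefix_getElem?]
      constructor
      · rintro rfl
        exact ⟨n + 1, B n, by simp⟩
      · rintro ⟨k, x, hx, rfl⟩
        split_ifs at hx
        cases hx
        rfl
  | pair _ _ ihf ihh =>
    obtain ⟨F, pF, mF, aF⟩ := ihf
    obtain ⟨G, pG, mG, aG⟩ := ihh
    refine ⟨fun τ n => (F τ n).bind fun x => (G τ n).map fun y => Nat.pair x y, ?_, ?_, ?_⟩
    · refine Partrec.bind pF ?_
      refine Partrec.map (Partrec.comp pG Computable.fst) ?_
      exact Primrec₂.natPair.to_comp.comp (Computable.snd.comp Computable.fst) Computable.snd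
    · intro a b hab n v hv
      simp only [Part.mem_bind_iff, Part.mem_map_iff] at hv ⊢
      obtain ⟨x, hx, y, hy, rfl⟩ := hv
      exact ⟨x, mF hab hx, y, mG hab hy, rfl⟩
    · intro n v
      simp only [Seq.seq, Part.map_eq_map, Part.mem_bind_iff, Part.mem_map_iff]
      constructor
      · rintro ⟨_, ⟨x, hx, rfl⟩, y, hy, rfl⟩
        obtain ⟨k, hk⟩ := (aF _ _).1 hx
        obtain ⟨l, hl⟩ := (aG _ _).1 hy
        exact ⟨max k l, x, mF.mem_of_le B (le_max_left _ _) hk, y,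
          mG.mem_of_le B (le_max_right _ _) hl, rfl⟩
      · rintro ⟨k, x, hx, y, hy, rfl⟩
        exact ⟨_, ⟨x, (aF _ _).2 ⟨k, hx⟩, rfl⟩, y, (aG _ _).2 ⟨k, hy⟩, rfl⟩
  | comp _ _ ihf ihh =>
    obtain ⟨F, pF, mF, aF⟩ := ihf
    obtain ⟨G, pG, mG, aG⟩ := ihh
    refine ⟨fun τ n => (G τ n).bind fun x => F τ x, ?_, ?_, ?_⟩
    · exact Partrec.bind pG (pF.comp (Computable.fst.comp Computable.fst) Computable.snd)
    · intro a b hab n v hv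
      simp only [Part.mem_bind_iff] at hv ⊢
      obtain ⟨x, hx, hv⟩ := hv
      exact ⟨x, mG hab hx, mF hab hv⟩
    · intro n v
      refine Part.mem_bind_iff.trans ?_
      simp only [Part.mem_bind_iff]
      constructor
      · rintro ⟨x, hx, hv⟩
        obtain ⟨k, hk⟩ := (aG _ _).1 hx
        obtain ⟨l, hl⟩ := (aF _ _).1 hv
        exact ⟨max k l, x, mG.mem_of_le B (le_max_left _ _) hk,
          mF.mem_of_le B (le_max_right _ _) hl⟩
      · rintro ⟨k, x, hx, hv⟩
        exact ⟨x, (aG _ _).2 ⟨k, hx⟩, (aF _ _).2 ⟨k, hv⟩⟩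
  | @prec f h _ _ ihf ihh =>
    obtain ⟨F, pF, mF, aF⟩ := ihf
    obtain ⟨G, pG, mG, aG⟩ := ihh
    refine ⟨fun τ p => partPrec (F τ) (G τ) p.unpair.1 p.unpair.2, ?_, ?_, ?_⟩
    · have un : Computable fun p : List Bool × ℕ => p.2.unpair :=
        Computable.unpair.comp Computable.snd
      refine Partrec.nat_rec (f := fun p : List Bool × ℕ => p.2.unpair.2)
        (g := fun p => F p.1 p.2.unpair.1)
        (h := fun p q => G p.1 (Nat.pair p.2.unpair.1 (Nat.pair q.1 q.2)))
        (Computable.snd.comp un) (pF.comp Computable.fst (Computable.fst.comp un)) ?_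
      refine pG.comp (Computable.fst.comp Computable.fst) ?_
      refine Primrec₂.natPair.to_comp.comp (Computable.fst.comp (un.comp Computable.fst)) ?_
      exact Primrec₂.natPair.to_comp.comp (Computable.fst.comp Computable.snd)
        (Computable.snd.comp Computable.snd)
    · intro a b hab p v hv
      exact partPrec_mono (fun _ _ h => mF hab h) (fun _ _ h => mG hab h) _ _ v hv
    · intro p v
      change v ∈ partPrec f h p.unpair.1 p.unpair.2 ↔ ∃ k, v ∈ partPrec (F (bitPrefix B k))
        (G (bitPrefix B k)) p.unpair.1 p.unpair.2
      generalize p.unpair.1 = a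
      generalize p.unpair.2 = n
      constructor
      · induction n generalizing v with
        | zero => exact fun hv => (aF _ _).1 hv
        | succ n ih =>
          intro hv
          rw [partPrec_succ, Part.mem_bind_iff] at hv
          obtain ⟨i, hi, hv⟩ := hv
          obtain ⟨k, hk⟩ := ih i hi
          obtain ⟨l, hl⟩ := (aG _ _).1 hv
          refine ⟨max k l, ?_⟩
          rw [partPrec_succ, Part.mem_bind_iff]
          exact ⟨i, mF.partPrec_mem_of_le mG B (le_max_left _ _) hk,
            mG.mem_of_le B (le_max_right _ _) hl⟩
      · rintro ⟨k, hk⟩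
        exact partPrec_mono (fun _ _ hv => (aF _ _).2 ⟨k, hv⟩) (fun _ _ hv => (aG _ _).2 ⟨k, hv⟩)
          _ _ _ hk
  | @rfind f _ ihf =>
    obtain ⟨F, pF, mF, aF⟩ := ihf
    refine ⟨fun τ a => Nat.rfind fun n => (F τ (Nat.pair a n)).map fun m => decide (m = 0),
      ?_, ?_, ?_⟩
    · refine Partrec.rfind (p := fun (q : List Bool × ℕ) n =>
        (F q.1 (Nat.pair q.2 n)).map fun m => decide (m = 0)) ?_
      refine Partrec.map (pF.comp (Computable.fst.comp Computable.fst)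
        (Primrec₂.natPair.to_comp.comp (Computable.snd.comp Computable.fst) Computable.snd)) ?_
      exact (Primrec.eq.decide.comp Primrec.snd (Primrec.const 0)).to_comp
    · intro a b hab n v hv
      obtain ⟨h₁, h₂⟩ := Nat.mem_rfind.1 hv
      simp only [Part.mem_map_iff] at h₁ h₂
      obtain ⟨m, hm, hm0⟩ := h₁
      refine Nat.mem_rfind.2 ⟨(Part.mem_map_iff _).2 ⟨m, mF hab hm, hm0⟩, fun {i} hi => ?_⟩
      obtain ⟨j, hj, hj0⟩ := h₂ hi
      exact (Part.mem_map_iff _).2 ⟨j, mF hab hj, hj0⟩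
    · intro n v
      refine Nat.mem_rfind.trans ((Eq.to_iff ?_).trans (exists_congr fun k => Nat.mem_rfind.symm))
      simp only [Part.map_eq_map, Part.mem_map_iff, eq_iff_iff]
      constructor
      · rintro ⟨⟨m, hm, hm0⟩, hv⟩
        obtain ⟨k, hk⟩ := (aF _ _).1 hm
        -- The bound `i < v` stands inside the existential so that `l` becomes a function of `i`
        -- alone. One prefix then serves the finitely many values tested below `v`.
        have : ∀ i, ∃ l, i < v → ∃ j ∈ F (bitPrefix B l) (Nat.pair n i), decide (j = 0) = false := by
          intro i
          by_cases hi : i < v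
          · obtain ⟨j, hj, hj0⟩ := hv hi
            obtain ⟨l, hl⟩ := (aF _ _).1 hj
            exact ⟨l, fun _ => ⟨j, hl, hj0⟩⟩
          · exact ⟨0, fun h => absurd h hi⟩
        choose l hl using this
        refine ⟨max k ((Finset.range v).sup l),
          ⟨m, mF.mem_of_le B (le_max_left _ _) hk, hm0⟩, fun {i} hi => ?_⟩
        obtain ⟨j, hj, hj0⟩ := hl i hi
        exact ⟨j, mF.mem_of_le B
          (le_max_of_le_right (Finset.le_sup (f := l) (Finset.mem_range.2 hi))) hj, hj0⟩
      · rintro ⟨k, ⟨m, hm, hm0⟩, hv⟩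
        refine ⟨⟨m, (aF _ _).2 ⟨k, hm⟩, hm0⟩, fun {i} hi => ?_⟩
        obtain ⟨j, hj, hj0⟩ := hv hi
        exact ⟨j, (aF _ _).2 ⟨k, hj⟩, hj0⟩

/-! ### Countability of functionals and computability by search -/

/-- There are only countably many partial recursive binary operations. -/
theorem countable_partrec₂ {α β σ : Type*} [Primcodable α] [Primcodable β] [Primcodable σ] :
    Countable {F : α → β →. σ // Partrec₂ F} := by
  choose c hc using fun F : {F : α → β →. σ // Partrec₂ F} => Nat.Partrec.Code.exists_code.1 F.2
  refine Function.Injective.countable (f := c) fun F G h => Subtype.ext ?_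
  funext a b
  have hF := congrFun (hc F) (Encodable.encode (a, b))
  have hG := congrFun (hc G) (Encodable.encode (a, b))
  rw [← h, hF] at hG
  simp only [Encodable.encodek, Part.coe_some, Part.bind_some] at hG
  ext v
  have := congrArg (Encodable.encode v ∈ ·) hG
  simpa [Part.mem_map_iff] using this

/-- A total function whose values are found, and never misidentified, by a partial recursive search
is computable. -/
theorem computable_of_search {α γ σ : Type*} [Primcodable α] [Primcodable γ] [Primcodable σ]
    {q : α × γ →. σ} (hq : Partrec q) {h : α → σ} (hex : ∀ a, ∃ c, h a ∈ q (a, c))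
    (huniq : ∀ a c v, v ∈ q (a, c) → v = h a) : Computable h := by
  obtain ⟨e, he⟩ := Nat.Partrec.Code.exists_code.1 hq
  have heval (a : α) (c : γ) :
      e.eval (Encodable.encode (a, c)) = (q (a, c)).map Encodable.encode :=
    (congrFun he _).trans (by simp)
  -- Dovetailing: `k` codes a candidate `c` together with a step bound, so that candidates on which
  -- `q` diverges do not block the search.
  let s : α → ℕ → Option σ := fun a k => (Encodable.decode (α := γ × ℕ) k).bind fun x =>
    (Nat.Partrec.Code.evaln x.2 e (Encodable.encode (a, x.1))).bind fun m =>
      Encodable.decode (α := σ) m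
  have hs : Computable₂ s := by
    refine Computable.option_bind (Computable.decode.comp Computable.snd) ?_
    refine Computable.option_bind ?_ (Computable.decode.comp Computable.snd)
    exact Nat.Partrec.Code.primrec_evaln.to_comp.comp
      (((Computable.snd.comp Computable.snd).pair (Computable.const e)).pair
        (Computable.encode.comp ((Computable.fst.comp Computable.fst).pair
          (Computable.fst.comp Computable.snd))))
  have sound : ∀ a k v, v ∈ s a k → v = h a := by
    intro a k v hv
    obtain ⟨⟨c, t⟩, -, hv⟩ := Option.bind_eq_some_iff.1 hv
    obtain ⟨m, hm, hv⟩ := Option.bind_eq_some_iff.1 hv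
    have := Nat.Partrec.Code.evaln_sound hm
    rw [heval, Part.mem_map_iff] at this
    obtain ⟨w, hw, rfl⟩ := this
    rw [Encodable.encodek, Option.some_inj] at hv
    exact hv ▸ huniq a c w hw
  refine Partrec.of_eq_tot (Partrec.rfindOpt hs) fun a => ?_
  obtain ⟨c, hc⟩ := hex a
  have : Encodable.encode (h a) ∈ e.eval (Encodable.encode (a, c)) := by
    rw [heval]
    exact Part.mem_map _ hc
  obtain ⟨t, ht⟩ := Nat.Partrec.Code.evaln_complete.1 this
  have hmem : h a ∈ s a (Encodable.encode (c, t)) := by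
    refine Option.bind_eq_some_iff.2 ⟨(c, t), Encodable.encodek _, ?_⟩
    exact Option.bind_eq_some_iff.2 ⟨_, ht, Encodable.encodek _⟩
  obtain ⟨v, hv⟩ := Part.dom_iff_mem.1 (Nat.rfindOpt_dom.2 ⟨_, _, hmem⟩)
  obtain ⟨k, hk⟩ := Nat.rfindOpt_spec hv
  exact sound a k v hk ▸ hv

/-- The inverse of a computable permutation of a coded type is computable. -/
theorem computable_symm {α β : Type*} [Primcodable α] [Primcodable β] (e : α ≃ β)
    (he : Computable e) : Computable e.symm := by
  classical
  refine computable_of_search (γ := α)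
    (q := fun p => ((if e p.2 = p.1 then some p.2 else none : Option α) : Part α)) ?_ ?_ ?_
  · refine Computable.ofOption ?_
    refine (Computable.cond (c := fun p : β × α => decide (e p.2 = p.1))
      (Primrec.eq.decide.to_comp.comp (he.comp Computable.snd) Computable.fst)
      (Computable.option_some.comp Computable.snd) (Computable.const none)).of_eq fun p => ?_
    by_cases h : e p.2 = p.1 <;> simp [h]
  · intro b
    exact ⟨e.symm b, by simp⟩
  · intro b a v hv
    simp only [Part.mem_ofOption, Option.mem_def] at hv
    split_ifs at hv with h
    cases hv
    exact ((Equiv.symm_apply_eq e).2 h.symm).symm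

/-! ### Baire category in Cantor space -/

/-- The sequence beginning with the finite string `τ` and continuing with zeros. -/
def padZeros (τ : List Bool) : ℕ → Bool := fun i => τ.getD i false

/-- Translates between finite strings and basic open sets, so that topological density can be read
as density among strings. -/
theorem bitPrefix_eq_iff {B : ℕ → Bool} {τ : List Bool} :
    bitPrefix B τ.length = τ ↔ B ∈ PiNat.cylinder (padZeros τ) τ.length := by
  rw [PiNat.mem_cylinder_iff]
  constructor
  · intro h i hi
    have : (bitPrefix B τ.length)[i]? = τ[i]? := by rw [h]
    rw [bitPrefix_getElem?, if_pos hi] at this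
    simp [padZeros, List.getD_eq_getElem?_getD, ← this]
  · intro h
    refine List.ext_getElem? fun i => ?_
    rw [bitPrefix_getElem?]
    split_ifs with hi
    · rw [h i hi, padZeros, List.getD_eq_getElem _ _ hi, List.getElem?_eq_getElem hi]
    · rw [List.getElem?_eq_none (not_lt.1 hi)]

/-- If Cantor space is covered by countably many sets, then one of them is dense above some finite
string. -/
theorem exists_dense_above {ι : Type*} [Countable ι] (E : ι → Set (ℕ → Bool))
    (hE : ∀ B, ∃ i, B ∈ E i) :
    ∃ i, ∃ σ : List Bool, ∀ τ, σ <+: τ → ∃ B ∈ E i, bitPrefix B τ.length = τ := by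
  -- The closures cover a Baire space, so one of them has an interior point `B`; a prefix of `B`
  -- whose cylinder lies in that interior serves as `σ`.
  obtain ⟨i, B, hB⟩ := nonempty_interior_of_iUnion_of_closed (f := fun i => closure (E i))
    (fun _ => isClosed_closure) (Set.eq_univ_of_forall fun B => by
      obtain ⟨i, hi⟩ := hE B
      exact Set.mem_iUnion.2 ⟨i, subset_closure hi⟩)
  obtain ⟨_, ⟨x, k, rfl⟩, hBx, hx⟩ :=
    (PiNat.isTopologicalBasis_cylinders fun _ => Bool).exists_subset_of_mem_open hB isOpen_interior
  refine ⟨i, bitPrefix B k, fun τ hτ => ?_⟩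
  have hmem : padZeros τ ∈ closure (E i) := by
    refine interior_subset (hx ?_)
    rw [PiNat.mem_cylinder_iff] at hBx ⊢
    intro j hj
    obtain ⟨ρ, rfl⟩ := hτ
    rw [← hBx j hj, padZeros, List.getD_eq_getElem?_getD,
      List.getElem?_append_left (by rwa [bitPrefix_length]), bitPrefix_getElem?, if_pos hj]
    rfl
  obtain ⟨A, hA, hAE⟩ := mem_closure_iff.1 hmem _
    (PiNat.isOpen_cylinder (fun _ => Bool) (padZeros τ) τ.length) (PiNat.self_mem_cylinder _ _)
  exact ⟨A, hAE, bitPrefix_eq_iff.2 hA⟩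

/-- `F` computes `B ∘ h` from `B`, for a set of sequences `B` that is dense above `σ`. -/
def DenselyComputes (F : List Bool → ℕ →. ℕ) (h : ℕ → ℕ) (σ : List Bool) : Prop :=
  ∀ τ, σ <+: τ → ∃ B : ℕ → Bool,
    Approximates F B (fun n => Part.some (B (h n)).toNat) ∧ bitPrefix B τ.length = τ

/-- By the use principle, the sets `E F` cover Cantor space, and there are countably many of them.
Monotonicity of `F` does not involve `B`, so any one member of `E F` supplies it. -/
theorem exists_denselyComputes {h : ℕ → ℕ}
    (H : ∀ B : ℕ → Bool, TuringReducible (fun n => Part.some (B (h n)).toNat)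
      (fun n => Part.some (B n).toNat)) :
    ∃ F σ, Partrec₂ F ∧ ExtensionMonotone F ∧ DenselyComputes F h σ := by
  have := countable_partrec₂ (α := List Bool) (β := ℕ) (σ := ℕ)
  let E : {F : List Bool → ℕ →. ℕ // Partrec₂ F} → Set (ℕ → Bool) := fun F =>
    {B | ExtensionMonotone F.1 ∧ Approximates F.1 B (fun n => Part.some (B (h n)).toNat)}
  obtain ⟨F, σ, hσ⟩ := exists_dense_above E fun B => by
    obtain ⟨F, pF, mF, aF⟩ := exists_approximates_of_recursiveIn (RecursiveIn.iff_nat.1 (H B))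
    exact ⟨⟨F, pF⟩, mF, aF⟩
  obtain ⟨B, hB, -⟩ := hσ σ List.prefix_rfl
  refine ⟨F.1, σ, F.2, hB.1, fun τ hτ => ?_⟩
  obtain ⟨A, hA, hAτ⟩ := hσ τ hτ
  exact ⟨A, hA.2, hAτ⟩

/-! ### Recovering `h` from a functional that works densely -/

namespace DenselyComputes

variable {F : List Bool → ℕ →. ℕ} {h : ℕ → ℕ} {σ : List Bool}

/-- A value computed from a string above `σ` is the bit of that string at the place `h n`, which
lies inside of the string. -/
theorem getElem?_eq (hd : DenselyComputes F h σ) (mF : ExtensionMonotone F) {τ : List Bool}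
    (hτ : σ <+: τ) {n v : ℕ} (hv : v ∈ F τ n) : ∃ b, τ[h n]? = some b ∧ v = b.toNat := by
  obtain ⟨B, hB, hBτ⟩ := hd τ hτ
  have key : ∀ {A : ℕ → Bool} {ρ : List Bool},
      Approximates F A (fun n => Part.some (A (h n)).toNat) → bitPrefix A ρ.length = ρ →
      v ∈ F ρ n → v = (A (h n)).toNat := by
    intro A ρ hA hAρ hv
    rw [← hAρ] at hv
    exact Part.mem_some_iff.1 ((hA n v).2 ⟨_, hv⟩)
  have hvB := key hB hBτ hv
  by_cases hlt : h n < τ.length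
  · refine ⟨B (h n), ?_, hvB⟩
    rw [← hBτ, bitPrefix_getElem?, if_pos hlt]
  · push Not at hlt
    -- If `h n` lay outside `τ`, then `τ` could be extended so that the bit at `h n` is the opposite
    -- of that of `B`. Monotonicity keeps the value `v`, but a sequence through `ρ` on which `F` is
    -- correct demands the other bit.
    set ρ := τ ++ List.replicate (h n - τ.length) false ++ [!B (h n)] with hρ
    have hτρ : τ <+: ρ := by
      rw [hρ, List.append_assoc]
      exact List.prefix_append _ _
    obtain ⟨A, hA, hAρ⟩ := hd ρ (hτ.trans hτρ)
    have hvA := key hA hAρ (mF hτρ hv)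
    have hget : ρ[h n]? = some (!B (h n)) := by
      rw [hρ, List.getElem?_append_right (by simp; omega)]
      have : h n - (τ ++ List.replicate (h n - τ.length) false).length = 0 := by simp; omega
      rw [this]
      rfl
    have hAn : A (h n) = !B (h n) := by
      have hlen := (List.getElem?_eq_some_iff.1 hget).1
      rw [← hAρ, bitPrefix_getElem?, if_pos hlen] at hget
      exact Option.some_inj.1 hget
    rw [hvB, hAn] at hvA
    cases hb : B (h n) <;> simp [hb] at hvA

/-- Every string above `σ` has an extension from which `F` converges. -/
theorem exists_mem (hd : DenselyComputes F h σ) (mF : ExtensionMonotone F) {τ : List Bool}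
    (hτ : σ <+: τ) (n : ℕ) : ∃ ρ v, v ∈ F (τ ++ ρ) n := by
  obtain ⟨B, hB, hBτ⟩ := hd τ hτ
  obtain ⟨k, hk⟩ := (hB n _).1 (Part.mem_some _)
  obtain ⟨ρ, hρ⟩ : τ <+: bitPrefix B (max k τ.length) := by
    conv_lhs => rw [← hBτ]
    exact bitPrefix_isPrefix B (le_max_right _ _)
  exact ⟨ρ, _, hρ ▸ mF.mem_of_le B (le_max_left _ _) hk⟩

/-- If two strings above `σ` differ in one place only and `F` computes different values from them,
then that place is `h n`. -/
theorem eq_of_ne (hd : DenselyComputes F h σ) (mF : ExtensionMonotone F) {α β : List Bool}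
    {n v w : ℕ} (hv : v ∈ F (σ ++ α ++ false :: β) n) (hw : w ∈ F (σ ++ α ++ true :: β) n)
    (hvw : v ≠ w) : (σ ++ α).length = h n := by
  have pre (x : Bool) : σ <+: σ ++ α ++ x :: β := by
    rw [List.append_assoc]
    exact List.prefix_append _ _
  obtain ⟨b, hb, rfl⟩ := hd.getElem?_eq mF (pre _) hv
  obtain ⟨c, hc, rfl⟩ := hd.getElem?_eq mF (pre _) hw
  by_contra hne
  refine hvw (congrArg _ (Option.some_inj.1 ?_))
  -- Both values are bits at place `h n`, and the two strings agree at every place other than the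
  -- flipped one.
  rw [← hb, ← hc, List.getElem?_append (l₁ := σ ++ α), List.getElem?_append (l₁ := σ ++ α)]
  split_ifs with hlt
  · rfl
  · obtain ⟨d, hd⟩ : ∃ d, h n - (σ ++ α).length = d + 1 :=
      ⟨h n - (σ ++ α).length - 1, by omega⟩
    rw [hd, List.getElem?_cons_succ, List.getElem?_cons_succ]

/-- The place `h n`, if it is not inside of `σ`, is witnessed by two strings as in `eq_of_ne`. -/
theorem exists_ne (hd : DenselyComputes F h σ) (mF : ExtensionMonotone F) {n : ℕ}
    (hn : σ.length ≤ h n) : ∃ α β v w, v ∈ F (σ ++ α ++ false :: β) n ∧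
      w ∈ F (σ ++ α ++ true :: β) n ∧ v ≠ w := by
  set α := List.replicate (h n - σ.length) false with hα
  have hlen : (σ ++ α).length = h n := by simp [hα]; omega
  have pre (β : List Bool) : σ <+: σ ++ α ++ β := by
    rw [List.append_assoc]
    exact List.prefix_append _ _
  -- Convergence is secured first after `false`, then after `true` followed by the tail just found.
  -- Monotonicity then allows the common tail `ρ ++ ρ'` in both strings.
  obtain ⟨ρ, v, hv⟩ := hd.exists_mem mF (pre [false]) n
  obtain ⟨ρ', w, hw⟩ := hd.exists_mem mF (pre (true :: ρ)) n
  have hv' : v ∈ F (σ ++ α ++ false :: (ρ ++ ρ')) n :=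
    mF ⟨ρ', by simp⟩ hv
  have hw' : w ∈ F (σ ++ α ++ true :: (ρ ++ ρ')) n := by
    simpa using hw
  refine ⟨α, ρ ++ ρ', v, w, hv', hw', ?_⟩
  obtain ⟨b, hb, rfl⟩ := hd.getElem?_eq mF (pre _) hv'
  obtain ⟨c, hc, rfl⟩ := hd.getElem?_eq mF (pre _) hw'
  rw [List.getElem?_append_right hlen.le, hlen, Nat.sub_self] at hb hc
  cases hb
  cases hc
  simp

/-- An injective function `h` such that `B ∘ h` is uniformly computable from densely many `B` is
computable. -/
theorem computable (hd : DenselyComputes F h σ) (pF : Partrec₂ F) (mF : ExtensionMonotone F)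
    (hinj : Function.Injective h) : Computable h := by
  -- By injectivity only finitely many `n` have `h n` inside `σ`, where no bit can be flipped; a
  -- finite table handles all `n < M`.
  obtain ⟨M, hM⟩ : ∃ M, ∀ n, h n < σ.length → n < M := by
    obtain ⟨M, hM⟩ := ((Set.finite_Iio σ.length).preimage hinj.injOn).bddAbove
    exact ⟨M + 1, fun n hn => Nat.lt_succ_of_le (hM hn)⟩
  -- Tests a pair `(α, β)` as a witness: if the two computed values differ, the flipped place is
  -- returned as `h n`.
  let r : ℕ × List Bool × List Bool →. ℕ := fun p =>
    (F (σ ++ p.2.1 ++ false :: p.2.2) p.1).bind fun v =>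
      (F (σ ++ p.2.1 ++ true :: p.2.2) p.1).bind fun w =>
        ((bif decide (v = w) then none else some (σ ++ p.2.1).length : Option ℕ) : Part ℕ)
  have app : Computable fun p : ℕ × List Bool × List Bool => σ ++ p.2.1 :=
    Computable.list_append.comp (Computable.const σ) (Computable.fst.comp Computable.snd)
  have arg (x : Bool) : Computable fun p : ℕ × List Bool × List Bool =>
      σ ++ p.2.1 ++ x :: p.2.2 :=
    Computable.list_append.comp app
      (Computable.list_cons.comp (Computable.const x) (Computable.snd.comp Computable.snd))
  have pr : Partrec r := by
    refine Partrec.bind (pF.comp (arg false) Computable.fst) ?_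
    refine Partrec.bind (Partrec.comp (pF.comp (arg true) Computable.fst) Computable.fst) ?_
    refine Computable.ofOption ?_
    refine Computable.cond (Primrec.eq.decide.to_comp.comp (Computable.snd.comp Computable.fst)
      Computable.snd) (Computable.const none) ?_
    exact Computable.option_some.comp (Computable.list_length.comp
      (app.comp (Computable.fst.comp Computable.fst)))
  have mem_r {n m : ℕ} {α β : List Bool} : m ∈ r (n, α, β) ↔ ∃ v w,
      v ∈ F (σ ++ α ++ false :: β) n ∧ w ∈ F (σ ++ α ++ true :: β) n ∧ v ≠ w ∧
        (σ ++ α).length = m := by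
    simp only [r, Part.mem_bind_iff]
    constructor
    · rintro ⟨v, hv, w, hw, hm⟩
      refine ⟨v, w, hv, hw, ?_⟩
      by_cases hvw : v = w <;> simp_all
    · rintro ⟨v, w, hv, hw, hvw, rfl⟩
      exact ⟨v, hv, w, hw, by simp [hvw]⟩
  refine computable_of_search (γ := List Bool × List Bool)
    -- The default `0` is never reached, since the table is consulted only below its length `M`.
    (q := fun p => bif decide (p.1 < M) then
      Part.some ((((List.range M).map h)[p.1]?).getD 0) else r p) ?_ ?_ ?_
  · refine Partrec.cond (Primrec.nat_lt.decide.to_comp.comp Computable.fst (Computable.const M))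
      ?_ pr
    exact Computable.option_getD (Computable.list_getElem?.comp (Computable.const _) Computable.fst)
      (Computable.const 0)
  · intro n
    by_cases hn : n < M
    · exact ⟨([], []), by simp [hn]⟩
    · obtain ⟨α, β, v, w, hv, hw, hvw⟩ := hd.exists_ne mF (n := n) (by
        by_contra hlt
        exact hn (hM n (not_le.1 hlt)))
      refine ⟨(α, β), ?_⟩
      simp only [hn, decide_false, cond_false]
      exact mem_r.2 ⟨v, w, hv, hw, hvw, hd.eq_of_ne mF hv hw hvw⟩
  · rintro n ⟨α, β⟩ m hm
    by_cases hn : n < M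
    · simpa [hn] using hm
    · simp only [hn, decide_false, cond_false] at hm
      obtain ⟨v, w, hv, hw, hvw, rfl⟩ := mem_r.1 hm
      exact hd.eq_of_ne mF hv hw hvw

end DenselyComputes

/-- If `B ∘ h` is computable from `B` for each binary sequence `B`, and `h` is injective, then `h`
is computable. -/
theorem computable_of_forall_turingReducible {h : ℕ → ℕ} (hinj : Function.Injective h)
    (H : ∀ B : ℕ → Bool, TuringReducible (fun n => Part.some (B (h n)).toNat)
      (fun n => Part.some (B n).toNat)) : Computable h := by
  obtain ⟨F, σ, pF, mF, hd⟩ := exists_denselyComputes H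
  exact hd.computable pF mF hinj

/-! ### From the conjugated successor to the permutation and the degrees -/

/-- A permutation which conjugates the successor function to a computable function is computable. -/
theorem computable_of_conj_succ (f : Equiv.Perm ℕ)
    (hf : Computable fun n => f.symm (f n + 1)) : Computable f := by
  have hsymm : Computable f.symm := by
    -- The recursion is f⁻¹(n + 1) = h(f⁻¹(n)) with h = f⁻¹ ∘ S ∘ f, started at the constant f⁻¹(0).
    refine (Computable.nat_rec (f := fun n : ℕ => n) (g := fun _ => f.symm 0)
      (h := fun _ p => f.symm (f p.2 + 1)) Computable.id (Computable.const _)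
      (hf.comp (Computable.snd.comp Computable.snd))).of_eq fun n => ?_
    induction n with
    | zero => rfl
    | succ n ih =>
      change f.symm (f _ + 1) = _
      rw [ih, Equiv.apply_symm_apply]
  exact computable_symm f.symm hsymm

namespace InfSeq

/-- The pullback by a computable function is computable from the original sequence. -/
theorem pullback_le {S : Set ℕ} {g : ℕ → ℕ} (hg : Computable g) (A : InfSeq S) :
    A.pullback g ≤ A := by
  refine RecursiveIn.iff_nat.2 ?_
  have h := Nat.RecursiveIn.comp (Nat.RecursiveIn.oracle (O := {A.toPFun}) A.toPFun rfl)
    (Nat.Partrec.recursiveIn (Partrec.nat_iff.1 hg.partrec))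
  refine h.of_eq fun n => ?_
  exact Part.bind_some _ _

/-- The sequence of bits `B`, as a member of `{0,1}^ω`. -/
def ofBits (B : ℕ → Bool) : InfSeq ({0, 1} : Set ℕ) := fun n =>
  ⟨(B n).toNat, by cases B n <;> simp⟩

/-- A map induced by `f` that is monotone makes the pullback by `f` monotone. -/
theorem pullback_le_pullback {S : Set ℕ} {π : DegreesOf S → DegreesOf S} {f : ℕ → ℕ}
    (hmono : Monotone π) (hπ : IsInducedBy π f) {A B : InfSeq S} (hAB : A ≤ B) :
    A.pullback f ≤ B.pullback f := by
  have h := hmono (toAntisymmetrization_le_toAntisymmetrization_iff.2 hAB)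
  change π A.degree ≤ π B.degree at h
  rw [hπ A, hπ B] at h
  exact toAntisymmetrization_le_toAntisymmetrization_iff.1 h

end InfSeq

/-- A permutation of `ω` inducing a monotone map of the Turing degrees of `{0,1}^ω` is computable. -/
theorem IsInducedBy.computable {f : Equiv.Perm ℕ}
    {π : DegreesOf ({0, 1} : Set ℕ) → DegreesOf ({0, 1} : Set ℕ)} (hmono : Monotone π)
    (hπ : IsInducedBy π f) : Computable f := by
  refine computable_of_conj_succ f (computable_of_forall_turingReducible ?_ fun B => ?_)
  · intro m n hmn
    simpa using hmn
  -- Applied to A ∘ S ≤ A for A = B ∘ f⁻¹: pulling back along `f` turns the right side into `B` and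
  -- the left side into B ∘ f⁻¹ ∘ S ∘ f.
  · have h := InfSeq.pullback_le_pullback hmono hπ
      (InfSeq.pullback_le Computable.succ ((InfSeq.ofBits B).pullback f.symm))
    have hB : ((InfSeq.ofBits B).pullback f.symm).pullback f = InfSeq.ofBits B := by
      funext n
      simp [InfSeq.pullback]
    rw [hB] at h
    exact h

/-- An automorphism `π` of the Turing degrees `D_2 = {0,1}^ω / ≡_T` that is induced by a permutation
`f` of `ω` is the identity; in other words, `f^*(p) ≡_T p` for each `p ∈ {0,1}^ω`. -/
theorem mainTheorem1 (f : Equiv.Perm ℕ)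
    (π : DegreesOf ({0, 1} : Set ℕ) ≃o DegreesOf ({0, 1} : Set ℕ))
    (hπ : IsInducedBy π f) :
    (∀ x : DegreesOf ({0, 1} : Set ℕ), π x = x) ∧
      ∀ p : InfSeq ({0, 1} : Set ℕ), TuringEquivalent (p.pullback f).toPFun p.toPFun := by
  have hf : Computable f := hπ.computable π.monotone
  have hf' : Computable f.symm := computable_symm f hf
  have hp (p : InfSeq ({0, 1} : Set ℕ)) : AntisymmRel (· ≤ ·) (p.pullback f) p := by
    refine ⟨InfSeq.pullback_le hf p, ?_⟩
    have h := InfSeq.pullback_le hf' (p.pullback f)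
    have : (p.pullback f).pullback f.symm = p := by
      funext n
      simp [InfSeq.pullback]
    rwa [this] at h
  refine ⟨fun x => ?_, hp⟩
  induction x using Quotient.inductionOn with
  | h p => exact (hπ p).trans (Quotient.sound (hp p))
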